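/- Let $d\ge 1$, let $\Omega\subset\mathbb{R}^d$ be open and bounded with Lipschitz boundary, and let $\Gamma\subset\Omega$ be a nonempty finite set. If $\Gamma$ has at least two points, let $R=\min\{|x-y| : x,y\in\Gamma,\ x\ne y\}$; if $\Gamma$ is a single point, let $R>0$ be any fixed number. Let $r_0>0$, $\alpha\ge 0$ with $\alpha>d-2$, and let $\gamma\in C^\infty(\overline{\Omega}\setminus\Gamma)$ satisfy $\gamma\ge 1$ on $\Omega\setminus\Gamma$ and $$\gamma(x)=1+\left(\frac{r_0}{\operatorname{dist}(x,\Gamma)}\right)^{\alpha}\quad\text{for } x\in\overline\Omega\setminus\Gamma \text{ with } \operatorname{dist}(x,\Gamma)\le \tfrac{R}{4}.$$ For $u\in H^1(\Omega)$ put $[u]^2=\int_\Omega\gamma|\nabla u|^2\,dx$ and $\|u\|_{H^1_\gamma(\Omega)}^2=\|u\|_{L^2(\Omega)}^2+[u]^2$, and let $H^1_\gamma(\Omega)=\{u\in H^1(\Omega): \|u\|_{H^1_\gamma(\Omega)}<\infty\}$. Endow $\mathbb{R}^\Gamma$ with the Euclidean norm. Then for every $u\in H^1_\gamma(\Omega)$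 and every $x\in\Gamma$ the limit $$\operatorname{Tr}[u](x)=\lim_{\varepsilon\to 0^+}\frac{1}{|B(x,\varepsilon)|}\int_{B(x,\varepsilon)}u\,dy$$ exists, and the operator $\operatorname{Tr}:H^1_\gamma(\Omega)\to\mathbb{R}^\Gamma$ so defined is linear and bounded: there is a constant $C$ such that $|\operatorname{Tr}[u]|\le C\|u\|_{H^1_\gamma(\Omega)}$ for all $u\in H^1_\gamma(\Omega)$. Moreover $\operatorname{Tr}[u](x)=u(x)$ whenever $u$ is continuous at $x\in\Gamma$. Furthermore, there is a constant $C$ such that for all $u,v\in H^1_\gamma(\Omega)$ with $\|u-v\|_{L^2(\Omega)}^{2/(\alpha+2)}\le R/2$, $$|\operatorname{Tr}[u]-\operatorname{Tr}[v]|\le C\,(1+[u]+[v])\,\|u-v\|_{L^2(\Omega)}^{1-d/(\alpha+2)}.$$ -/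

import Mathlib

open MeasureTheory Set Filter Topology
open scoped ContDiff

/-- `Ω` has a Lipschitz boundary: near each boundary point `p`, after a choice of an orthonormal
frame with "vertical" unit vector `e`, the set `Ω` is the region strictly above the graph of a
Lipschitz function of the remaining coordinates. The point `x - ⟪e, x⟫ e` is the orthogonal
projection of `x` to the hyperplane `e^⊥`, so only the values of `f` on `e^⊥` matter. -/
def HasLipschitzBoundary {d : ℕ} (Ω : Set (EuclideanSpace ℝ (Fin d))) : Prop :=
  ∀ p ∈ frontier Ω, ∃ (r : ℝ) (e : EuclideanSpace ℝ (Fin d))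
    (K : NNReal) (f : EuclideanSpace ℝ (Fin d) → ℝ),
    0 < r ∧ ‖e‖ = 1 ∧ LipschitzWith K f ∧
    Ω ∩ Metric.ball p r =
      {x | x ∈ Metric.ball p r ∧ f (x - inner ℝ e x • e) < inner ℝ e x}

/-- `G` is a weak gradient of `u` in the open set `Ω`: for every test function `φ ∈ C_c^∞(Ω)` and
every direction `v`, `∫_Ω u ∂_v φ = - ∫_Ω (G ⬝ v) φ`. -/
def IsWeakGradient {d : ℕ} (Ω : Set (EuclideanSpace ℝ (Fin d)))
    (u : EuclideanSpace ℝ (Fin d) → ℝ)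
    (G : EuclideanSpace ℝ (Fin d) → EuclideanSpace ℝ (Fin d)) : Prop :=
  LocallyIntegrableOn u Ω volume ∧ LocallyIntegrableOn G Ω volume ∧
    ∀ φ : EuclideanSpace ℝ (Fin d) → ℝ, ContDiff ℝ ∞ φ → HasCompactSupport φ → tsupport φ ⊆ Ω →
      ∀ v : EuclideanSpace ℝ (Fin d),
        ∫ x in Ω, u x * fderiv ℝ φ x v = - ∫ x in Ω, inner ℝ (G x) v * φ x

open Classical in
/-- The weak gradient `∇u` of `u` in `Ω`, which is unique up to null sets in `Ω`
(zero if `u` has none). -/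
noncomputable def weakGradient {d : ℕ} (Ω : Set (EuclideanSpace ℝ (Fin d)))
    (u : EuclideanSpace ℝ (Fin d) → ℝ) : EuclideanSpace ℝ (Fin d) → EuclideanSpace ℝ (Fin d) :=
  if h : ∃ G, IsWeakGradient Ω u G then h.choose else 0

/-- `u` (restricted to `Ω`) belongs to the Sobolev space `H^1(Ω)`. -/
def MemH1 {d : ℕ} (Ω : Set (EuclideanSpace ℝ (Fin d)))
    (u : EuclideanSpace ℝ (Fin d) → ℝ) : Prop :=
  MemLp u 2 (volume.restrict Ω) ∧ (∃ G, IsWeakGradient Ω u G) ∧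
    MemLp (weakGradient Ω u) 2 (volume.restrict Ω)

/-- The weighted Dirichlet energy `[u]²_{H^1_γ(Ω)} = ∫_Ω γ |∇u|² dx`, as an extended
nonnegative number. -/
noncomputable def weightedEnergy {d : ℕ} (Ω : Set (EuclideanSpace ℝ (Fin d)))
    (γ : EuclideanSpace ℝ (Fin d) → ℝ) (u : EuclideanSpace ℝ (Fin d) → ℝ) : ENNReal :=
  ∫⁻ x in Ω, ENNReal.ofReal (γ x * ‖weakGradient Ω u x‖ ^ 2)

/-- `u` belongs to the weighted Sobolev space `H^1_γ(Ω)`. -/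
def MemH1Weighted {d : ℕ} (Ω : Set (EuclideanSpace ℝ (Fin d)))
    (γ : EuclideanSpace ℝ (Fin d) → ℝ) (u : EuclideanSpace ℝ (Fin d) → ℝ) : Prop :=
  MemH1 Ω u ∧ weightedEnergy Ω γ u < ⊤

/-- The norm `‖u‖_{L²(Ω)}`. -/
noncomputable def normL2 {d : ℕ} (Ω : Set (EuclideanSpace ℝ (Fin d)))
    (u : EuclideanSpace ℝ (Fin d) → ℝ) : ℝ :=
  (eLpNorm u 2 (volume.restrict Ω)).toReal

/-- The seminorm `[u]_{H^1_γ(Ω)}`. -/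
noncomputable def seminormH1Weighted {d : ℕ} (Ω : Set (EuclideanSpace ℝ (Fin d)))
    (γ : EuclideanSpace ℝ (Fin d) → ℝ) (u : EuclideanSpace ℝ (Fin d) → ℝ) : ℝ :=
  Real.sqrt (weightedEnergy Ω γ u).toReal

/-- The norm `‖u‖_{H^1_γ(Ω)}`. -/
noncomputable def normH1Weighted {d : ℕ} (Ω : Set (EuclideanSpace ℝ (Fin d)))
    (γ : EuclideanSpace ℝ (Fin d) → ℝ) (u : EuclideanSpace ℝ (Fin d) → ℝ) : ℝ :=
  Real.sqrt (normL2 Ω u ^ 2 + seminormH1Weighted Ω γ u ^ 2)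

/-- The average of `u` over the ball `B(x, ε)`. -/
noncomputable def ballAverage {d : ℕ} (u : EuclideanSpace ℝ (Fin d) → ℝ)
    (x : EuclideanSpace ℝ (Fin d)) (ε : ℝ) : ℝ :=
  ⨍ y in Metric.ball x ε, u y

/-- The pointwise trace `Tr[u] ∈ ℝ^Γ` (with the Euclidean norm), `Tr[u](x)` being the limit of the
averages of `u` over `B(x, ε)` as `ε → 0+`. -/
noncomputable def pointTrace {d : ℕ} (Γ : Finset (EuclideanSpace ℝ (Fin d)))
    (u : EuclideanSpace ℝ (Fin d) → ℝ) : EuclideanSpace ℝ Γ :=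
  WithLp.toLp 2 fun x => limUnder (𝓝[>] (0 : ℝ)) (ballAverage u x)

/-- `R` is the separation of the finite set `Γ`: the minimal distance between two distinct points
of `Γ`. If `Γ` has no two distinct points, that minimum does not exist, and `R` may be any positive
number. -/
def IsSeparation {d : ℕ} (Γ : Finset (EuclideanSpace ℝ (Fin d))) (R : ℝ) : Prop :=
  0 < R ∧ ((Γ : Set (EuclideanSpace ℝ (Fin d))).Nontrivial →
    IsLeast {t : ℝ | ∃ x ∈ Γ, ∃ y ∈ Γ, x ≠ y ∧ t = dist x y} R)

/-- `γ` is an admissible weight on `Ω`: smooth on `closure Ω \ Γ`, at least `1` on `Ω`, and equal to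
`1 + (r₀ / dist(x, Γ))^α` wherever `dist(x, Γ) ≤ R / 4`. (Its values on the finite set `Γ`, where it
is singular, are irrelevant.) -/
structure IsWeight {d : ℕ} (Ω : Set (EuclideanSpace ℝ (Fin d)))
    (Γ : Finset (EuclideanSpace ℝ (Fin d))) (R r₀ α : ℝ)
    (γ : EuclideanSpace ℝ (Fin d) → ℝ) : Prop where
  smooth : ContDiffOn ℝ ∞ γ (closure Ω \ (Γ : Set (EuclideanSpace ℝ (Fin d))))
  one_le : ∀ x ∈ Ω \ (Γ : Set (EuclideanSpace ℝ (Fin d))), 1 ≤ γ x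
  eq_near : ∀ x ∈ closure Ω \ (Γ : Set (EuclideanSpace ℝ (Fin d))),
    Metric.infDist x (Γ : Set (EuclideanSpace ℝ (Fin d))) ≤ R / 4 →
      γ x = 1 + (r₀ / Metric.infDist x (Γ : Set (EuclideanSpace ℝ (Fin d)))) ^ α

/-! Fix `x ∈ Γ` and let `A(t)` be the average of `u` over `B(x, t)`. Formally, `A'(t)` is `t⁻ᵈ⁻¹`
times the integral of `∇u · (y - x)` over `B(x, t)`, up to the volume of the unit ball. For small
`t` the weight is at least `(r₀/t)^α` on this ball, so the `L²` norm of `∇u` there is at most `[u]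
(t/r₀)^(α/2)`. Cauchy-Schwarz then gives `|A'(t)| ≤ c [u] t^(β-1)` with `β = (α + 2 - d)/2`. The
condition `α > d - 2` says exactly that `β > 0`, so this bound is integrable at `0` and `|A(t) -
A(s)| ≤ C [u] t^β` for `s ≤ t` (`abs_ballAverage_sub_le`). The averages are therefore Cauchy, with
rate `t^β` towards the trace.

To use only the weak gradient, the ball indicator is replaced by a smooth cutoff `χ`. The
`t`-derivative of `t⁻ᵈ χ((y - x)/t)` is the divergence of a compactly supported field, hence can be
moved onto `∇u` (`IsUnitCutoff.hasDerivAt_smoothAverage`). The resulting bounds do not depend on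
`χ`, which may then tend to the indicator.

Boundedness compares the trace with the average at one fixed radius, itself controlled by `t^(-d/2)
‖u‖_{L²}`. For stability, the errors `([u] + [v]) t^β` and `t^(-d/2) ‖u - v‖_{L²}` are balanced by
taking `t` proportional to `‖u - v‖_{L²}^(2/(α+2))`. Only the energies of `u` and `v` enter, never
that of `u - v`. -/

/-- A smooth cutoff with values in `[0, 1]` that vanishes outside the open unit ball. -/
structure IsUnitCutoff {d : ℕ} (χ : EuclideanSpace ℝ (Fin d) → ℝ) : Prop where
  smooth : ContDiff ℝ ∞ χ
  nonneg : ∀ z, 0 ≤ χ z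
  le_one : ∀ z, χ z ≤ 1
  eq_zero : ∀ z, 1 ≤ ‖z‖ → χ z = 0

/-- The divergence of the radial field `z ↦ χ z • z`. -/
noncomputable def radialDiv {d : ℕ} (χ : EuclideanSpace ℝ (Fin d) → ℝ)
    (z : EuclideanSpace ℝ (Fin d)) : ℝ :=
  d * χ z + fderiv ℝ χ z z

/-! ### Smooth averages and their derivative in the radius -/

namespace IsUnitCutoff

variable {d : ℕ} {χ : EuclideanSpace ℝ (Fin d) → ℝ}

lemma norm_le_one (h : IsUnitCutoff χ) (z : EuclideanSpace ℝ (Fin d)) : ‖χ z‖ ≤ 1 := by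
  rw [Real.norm_of_nonneg (h.nonneg z)]; exact h.le_one z

lemma tsupport_subset (h : IsUnitCutoff χ) : tsupport χ ⊆ Metric.closedBall 0 1 := by
  refine closure_minimal (fun z hz => ?_) Metric.isClosed_closedBall
  by_contra hz'
  rw [mem_closedBall_zero_iff, not_le] at hz'
  exact hz (h.eq_zero z hz'.le)

lemma hasCompactSupport (h : IsUnitCutoff χ) : HasCompactSupport χ :=
  (isCompact_closedBall _ _).of_isClosed_subset (isClosed_tsupport _) h.tsupport_subset

lemma continuous_radialDiv (h : IsUnitCutoff χ) : Continuous (radialDiv χ) := by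
  have h1 := h.smooth.continuous
  have h2 := h.smooth.continuous_fderiv (by simp)
  exact (continuous_const.mul h1).add (h2.clm_apply continuous_id)

lemma exists_bound_radialDiv (h : IsUnitCutoff χ) : ∃ M, ∀ z, ‖radialDiv χ z‖ ≤ M := by
  refine HasCompactSupport.exists_bound_of_continuous (f := radialDiv χ) ?_ h.continuous_radialDiv
  refine HasCompactSupport.intro h.hasCompactSupport (fun z hz => ?_)
  have h1 : χ z = 0 := image_eq_zero_of_notMem_tsupport hz
  have h2 : fderiv ℝ χ z = 0 :=
    Function.notMem_support.1 fun h' => hz (support_fderiv_subset ℝ h')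
  simp [radialDiv, h1, h2]

/-- The scaled cutoff `t⁻ᵈ χ(w / t)` has `t`-derivative `-t⁻ᵈ⁻¹ div(χ(z) z)` at `z = w / t`. -/
lemma hasDerivAt_scaled (h : IsUnitCutoff χ) (w : EuclideanSpace ℝ (Fin d)) {t : ℝ} (ht : 0 < t) :
    HasDerivAt (fun s : ℝ => (s ^ d)⁻¹ * χ (s⁻¹ • w))
      (-((t ^ (d + 1))⁻¹ * radialDiv χ (t⁻¹ • w))) t := by
  have hχ : HasFDerivAt χ (fderiv ℝ χ (t⁻¹ • w)) (t⁻¹ • w) :=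
    (h.smooth.differentiable (by simp) _).hasFDerivAt
  have h1 : HasDerivAt (fun s : ℝ => s⁻¹ • w) (-(t ^ 2)⁻¹ • w) t :=
    (hasDerivAt_inv ht.ne').smul_const w
  have h2 := hχ.comp_hasDerivAt t h1
  have h3 : HasDerivAt (fun s : ℝ => (s ^ d)⁻¹) (-(d * (t ^ (d + 1))⁻¹)) t := by
    refine ((hasDerivAt_pow d t).inv (by positivity)).congr_deriv ?_
    -- The derivative of `s ^ d` carries the truncated exponent `d - 1`, so `d = 0` is separate.
    rcases d with _ | d
    · simp
    · simp only [Nat.add_sub_cancel]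
      field_simp
      ring
  refine (h3.mul h2).congr_deriv ?_
  simp only [radialDiv, map_smul, smul_eq_mul, Function.comp]
  field_simp
  ring

variable {x : EuclideanSpace ℝ (Fin d)} {t : ℝ}

lemma continuous_scaled (h : IsUnitCutoff χ) (x : EuclideanSpace ℝ (Fin d)) (t : ℝ) :
    Continuous fun y => χ (t⁻¹ • (y - x)) :=
  h.smooth.continuous.comp (by fun_prop)

lemma scaled_eq_zero (h : IsUnitCutoff χ) (ht : 0 < t) {y : EuclideanSpace ℝ (Fin d)}
    (hy : y ∉ Metric.ball x t) : χ (t⁻¹ • (y - x)) = 0 := by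
  refine h.eq_zero _ ?_
  rw [Metric.mem_ball, not_lt, dist_eq_norm] at hy
  rw [norm_smul, norm_inv, Real.norm_of_nonneg ht.le, ← div_eq_inv_mul, one_le_div ht]
  exact hy

/-- Testing the weak gradient with the components of the field `χ((y - x) / t) (y - x)`. -/
lemma integral_radialDiv (h : IsUnitCutoff χ) {Ω : Set (EuclideanSpace ℝ (Fin d))}
    {u : EuclideanSpace ℝ (Fin d) → ℝ}
    {G : EuclideanSpace ℝ (Fin d) → EuclideanSpace ℝ (Fin d)} (hG : IsWeakGradient Ω u G)
    (hu : IntegrableOn u Ω) (hGi : IntegrableOn G Ω) (ht : 0 < t)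
    (hball : Metric.closedBall x t ⊆ Ω) :
    ∫ y in Ω, u y * radialDiv χ (t⁻¹ • (y - x)) =
      -∫ y in Ω, inner ℝ (G y) (y - x) * χ (t⁻¹ • (y - x)) := by
  set φ : Fin d → EuclideanSpace ℝ (Fin d) → ℝ := fun i y => (y - x) i * χ (t⁻¹ • (y - x)) with hφ
  set e : Fin d → EuclideanSpace ℝ (Fin d) := fun i => EuclideanSpace.single i 1 with he
  have hsm (i) : ContDiff ℝ ∞ (φ i) := by
    refine ContDiff.mul ?_ (h.smooth.comp (by fun_prop))
    exact (EuclideanSpace.proj (𝕜 := ℝ) i).contDiff.comp (contDiff_id.sub contDiff_const)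
  have hts (i) : tsupport (φ i) ⊆ Metric.closedBall x t := by
    refine closure_minimal (fun y hy => ?_) Metric.isClosed_closedBall
    by_contra hy'
    exact hy (by simp [hφ, h.scaled_eq_zero ht fun h' => hy' (Metric.ball_subset_closedBall h')])
  have hcs (i) : HasCompactSupport (φ i) :=
    (isCompact_closedBall _ _).of_isClosed_subset (isClosed_tsupport _) (hts i)
  have key (i) := hG.2.2 (φ i) (hsm i) (hcs i) ((hts i).trans hball) (e i)
  -- The factor `(y - x) i` absorbs the `t⁻¹` of the chain rule, so the divergence is a function of
  -- `(y - x)/t` alone.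
  have hfd (i) (y) : fderiv ℝ (φ i) y (e i) =
      χ (t⁻¹ • (y - x)) + (t⁻¹ • (y - x)) i * fderiv ℝ χ (t⁻¹ • (y - x)) (e i) := by
    have hχ : HasFDerivAt χ (fderiv ℝ χ (t⁻¹ • (y - x))) (t⁻¹ • (y - x)) :=
      (h.smooth.differentiable (by simp) _).hasFDerivAt
    have h1 : HasFDerivAt (fun y : EuclideanSpace ℝ (Fin d) => t⁻¹ • (y - x))
        (t⁻¹ • ContinuousLinearMap.id ℝ _) y := ((hasFDerivAt_id y).sub_const x).const_smul t⁻¹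
    have h2 : HasFDerivAt (fun y : EuclideanSpace ℝ (Fin d) => (y - x) i)
        ((EuclideanSpace.proj (𝕜 := ℝ) i).comp (ContinuousLinearMap.id ℝ _)) y :=
      (EuclideanSpace.proj (𝕜 := ℝ) i).hasFDerivAt.comp y ((hasFDerivAt_id y).sub_const x)
    have h3 : HasFDerivAt (φ i) _ y := h2.mul (hχ.comp y h1)
    rw [h3.fderiv]
    simp [he]
    ring
  have hsum (y) : ∑ i, fderiv ℝ (φ i) y (e i) = radialDiv χ (t⁻¹ • (y - x)) := by
    simp only [hfd, Finset.sum_add_distrib, radialDiv]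
    congr 1
    · simp
    · have hz : ∀ z : EuclideanSpace ℝ (Fin d), z = ∑ i, z i • e i := fun z => by
        ext j; simp [he, Pi.single_apply]
      conv_rhs => enter [2]; rw [hz (t⁻¹ • (y - x))]
      simp only [map_sum, map_smul, smul_eq_mul]
  have hi1 (i) : Integrable (fun y => u y * fderiv ℝ (φ i) y (e i)) (volume.restrict Ω) := by
    have hc : Continuous fun y => fderiv ℝ (φ i) y (e i) :=
      ((hsm i).continuous_fderiv (by simp)).clm_apply continuous_const
    obtain ⟨M, hM⟩ := ((hcs i).fderiv_apply (𝕜 := ℝ) (e i)).exists_bound_of_continuous hc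
    exact Integrable.mul_bdd hu hc.aestronglyMeasurable (Eventually.of_forall hM)
  have hi2 (i) : Integrable (fun y => inner ℝ (G y) (e i) * φ i y) (volume.restrict Ω) := by
    obtain ⟨M, hM⟩ := (hcs i).exists_bound_of_continuous (hsm i).continuous
    exact Integrable.mul_bdd (hGi.inner_const (𝕜 := ℝ) (e i)) (hsm i).continuous.aestronglyMeasurable
      (Eventually.of_forall hM)
  have hL : ∫ y in Ω, u y * radialDiv χ (t⁻¹ • (y - x)) =
      ∑ i, ∫ y in Ω, u y * fderiv ℝ (φ i) y (e i) := by
    rw [← integral_finsetSum _ fun i _ => hi1 i]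
    simp_rw [← Finset.mul_sum, hsum]
  have hR : ∫ y in Ω, inner ℝ (G y) (y - x) * χ (t⁻¹ • (y - x)) =
      ∑ i, ∫ y in Ω, inner ℝ (G y) (e i) * φ i y := by
    rw [← integral_finsetSum _ fun i _ => hi2 i]
    congr 1 with y
    simp only [hφ, he, ← mul_assoc, ← Finset.sum_mul]
    congr 1
    simp [PiLp.inner_apply, mul_comm]
  rw [hL, hR, ← Finset.sum_neg_distrib]
  exact Finset.sum_congr rfl fun i _ => key i

/-- The `t`-derivative of the smooth averages of `u`, in terms of the weak gradient. -/
lemma hasDerivAt_smoothAverage (h : IsUnitCutoff χ) {Ω : Set (EuclideanSpace ℝ (Fin d))}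
    {u : EuclideanSpace ℝ (Fin d) → ℝ}
    {G : EuclideanSpace ℝ (Fin d) → EuclideanSpace ℝ (Fin d)} (hG : IsWeakGradient Ω u G)
    (hu : IntegrableOn u Ω) (hGi : IntegrableOn G Ω) (ht : 0 < t)
    (hball : Metric.closedBall x t ⊆ Ω) :
    HasDerivAt (fun s : ℝ => ∫ y in Ω, u y * ((s ^ d)⁻¹ * χ (s⁻¹ • (y - x))))
      ((t ^ (d + 1))⁻¹ * ∫ y in Ω, inner ℝ (G y) (y - x) * χ (t⁻¹ • (y - x))) t := by
  obtain ⟨M, hM⟩ := h.exists_bound_radialDiv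
  have hcont (s : ℝ) : Continuous fun y => (s ^ d)⁻¹ * χ (s⁻¹ • (y - x)) :=
    continuous_const.mul (h.continuous_scaled x s)
  have hcont' (s : ℝ) :
      Continuous fun y : EuclideanSpace ℝ (Fin d) => radialDiv χ (s⁻¹ • (y - x)) :=
    h.continuous_radialDiv.comp (by fun_prop)
  -- Restricting to `s > t/2` keeps `s` away from `0`, which gives a dominating function independent
  -- of `s`.
  have main := (hasDerivAt_integral_of_dominated_loc_of_deriv_le
    (μ := volume.restrict Ω) (x₀ := t) (s := Ioi (t / 2))
    (F := fun (s : ℝ) y => u y * ((s ^ d)⁻¹ * χ (s⁻¹ • (y - x))))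
    (F' := fun (s : ℝ) y => u y * (-((s ^ (d + 1))⁻¹ * radialDiv χ (s⁻¹ • (y - x)))))
    (bound := fun y => ‖u y‖ * (((t / 2) ^ (d + 1))⁻¹ * M))
    (Ioi_mem_nhds (by linarith))
    (Eventually.of_forall fun s => hu.1.mul (hcont s).aestronglyMeasurable)
    (Integrable.mul_bdd (c := |(t ^ d)⁻¹| * 1) hu (hcont t).aestronglyMeasurable
      (Eventually.of_forall fun y => by
        rw [norm_mul, Real.norm_eq_abs]
        exact mul_le_mul_of_nonneg_left (h.norm_le_one _) (abs_nonneg _)))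
    (hu.1.mul (continuous_const.mul (hcont' t)).neg.aestronglyMeasurable)
    (Eventually.of_forall fun y s hs => by
      have hs0 : 0 < s := lt_trans (by positivity) (mem_Ioi.1 hs)
      have hle : (s ^ (d + 1))⁻¹ ≤ ((t / 2) ^ (d + 1))⁻¹ :=
        inv_anti₀ (by positivity) (pow_le_pow_left₀ (by positivity) (le_of_lt hs) _)
      rw [norm_mul, norm_neg, norm_mul, Real.norm_of_nonneg (by positivity : 0 ≤ (s ^ (d + 1))⁻¹)]
      exact mul_le_mul_of_nonneg_left
        (mul_le_mul hle (hM _) (norm_nonneg _) (by positivity)) (norm_nonneg _))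
    (hu.norm.mul_const _)
    (Eventually.of_forall fun y s hs =>
      (h.hasDerivAt_scaled (y - x) (lt_trans (by positivity) (mem_Ioi.1 hs))).const_mul (u y))).2
  refine main.congr_deriv ?_
  have h4 := h.integral_radialDiv hG hu hGi ht hball
  rw [← neg_eq_iff_eq_neg] at h4
  rw [← h4, ← integral_neg, ← integral_const_mul]
  congr 1 with y
  ring

end IsUnitCutoff

/-! ### Volumes of balls and Cauchy-Schwarz -/

section BallEstimates

variable {d : ℕ}

/-- The volume of the unit ball. -/
noncomputable def unitBallVolume (d : ℕ) : ℝ :=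
  volume.real (Metric.ball (0 : EuclideanSpace ℝ (Fin d)) 1)

lemma unitBallVolume_pos : 0 < unitBallVolume d :=
  ENNReal.toReal_pos (Metric.measure_ball_pos _ _ one_pos).ne' measure_ball_lt_top.ne

lemma volume_real_ball (x : EuclideanSpace ℝ (Fin d)) {t : ℝ} (ht : 0 < t) :
    volume.real (Metric.ball x t) = t ^ d * unitBallVolume d := by
  rw [Measure.real, Measure.addHaar_ball_of_pos _ _ ht, ENNReal.toReal_mul,
    ENNReal.toReal_ofReal (by positivity), finrank_euclideanSpace_fin]
  rfl

/-- Cauchy-Schwarz on a ball. -/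
lemma integral_norm_ball_le {F : Type*} [NormedAddCommGroup F] {f : EuclideanSpace ℝ (Fin d) → F}
    {x : EuclideanSpace ℝ (Fin d)} {t b : ℝ} (ht : 0 < t) (hb : 0 ≤ b)
    (hf : AEStronglyMeasurable f (volume.restrict (Metric.ball x t)))
    (hfb : eLpNorm f 2 (volume.restrict (Metric.ball x t)) ≤ ENNReal.ofReal b) :
    ∫ y in Metric.ball x t, ‖f y‖ ≤ b * Real.sqrt (t ^ d * unitBallVolume d) := by
  have h1 := eLpNorm_le_eLpNorm_mul_rpow_measure_univ (p := 1) (q := 2) (by norm_num) hf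
  rw [integral_norm_eq_lintegral_enorm hf, ← eLpNorm_one_eq_lintegral_enorm]
  refine ENNReal.toReal_le_of_le_ofReal (by positivity) (h1.trans ?_)
  rw [ENNReal.ofReal_mul hb]
  refine mul_le_mul' hfb (le_of_eq ?_)
  rw [Measure.restrict_apply_univ, ← ofReal_measureReal measure_ball_lt_top.ne,
    volume_real_ball x ht, Real.sqrt_eq_rpow,
    ENNReal.ofReal_rpow_of_nonneg (by have := unitBallVolume_pos (d := d); positivity)
      (by norm_num)]
  norm_num

lemma ballAverage_eq (u : EuclideanSpace ℝ (Fin d) → ℝ) (x : EuclideanSpace ℝ (Fin d)) {t : ℝ}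
    (ht : 0 < t) :
    ballAverage u x t = (unitBallVolume d)⁻¹ * ((t ^ d)⁻¹ * ∫ y in Metric.ball x t, u y) := by
  rw [ballAverage, setAverage_eq, volume_real_ball x ht, smul_eq_mul, mul_inv]
  ring

lemma sqrt_pow_mul_unitBallVolume {t : ℝ} (ht : 0 < t) :
    (t ^ d)⁻¹ * Real.sqrt (t ^ d * unitBallVolume d) =
      Real.sqrt (unitBallVolume d) * t ^ (-(d : ℝ) / 2) := by
  rw [Real.sqrt_mul (by positivity), Real.sqrt_eq_rpow (t ^ d), ← Real.rpow_natCast,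
    ← Real.rpow_neg ht.le, ← Real.rpow_mul ht.le, ← mul_assoc, ← Real.rpow_add ht, mul_comm]
  congr 2
  ring

/-- A ball average is controlled by the `L²` norm. -/
lemma abs_ballAverage_le {u : EuclideanSpace ℝ (Fin d) → ℝ} {x : EuclideanSpace ℝ (Fin d)}
    {t b : ℝ} (ht : 0 < t) (hb : 0 ≤ b)
    (hu : AEStronglyMeasurable u (volume.restrict (Metric.ball x t)))
    (hub : eLpNorm u 2 (volume.restrict (Metric.ball x t)) ≤ ENNReal.ofReal b) :
    |ballAverage u x t| ≤ (unitBallVolume d)⁻¹ * Real.sqrt (unitBallVolume d) *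
      (b * t ^ (-(d : ℝ) / 2)) := by
  have hω := unitBallVolume_pos (d := d)
  rw [ballAverage_eq u x ht, abs_mul, abs_mul, abs_of_pos (inv_pos.2 hω),
    abs_of_pos (inv_pos.2 (pow_pos ht d)), mul_assoc]
  refine mul_le_mul_of_nonneg_left ?_ (inv_pos.2 hω).le
  calc (t ^ d)⁻¹ * |∫ y in Metric.ball x t, u y|
      ≤ (t ^ d)⁻¹ * (b * Real.sqrt (t ^ d * unitBallVolume d)) := by
        refine mul_le_mul_of_nonneg_left ?_ (by positivity)
        exact (norm_integral_le_integral_norm _).trans (integral_norm_ball_le ht hb hu hub)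
    _ = b * ((t ^ d)⁻¹ * Real.sqrt (t ^ d * unitBallVolume d)) := by ring
    _ = _ := by rw [sqrt_pow_mul_unitBallVolume ht]; ring

end BallEstimates

/-- Comparison with `c/β (r^β - s^β)`, the primitive of the derivative bound that vanishes at `s`.
Dropping `s^β` makes the bound uniform in `s`. -/
lemma abs_sub_le_rpow_of_hasDerivAt {A A' : ℝ → ℝ} {c β s t : ℝ} (hβ : 0 < β) (hs : 0 < s)
    (hst : s ≤ t) (hc : 0 ≤ c) (hA : ∀ r ∈ Icc s t, HasDerivAt A (A' r) r)
    (hA' : ∀ r ∈ Icc s t, |A' r| ≤ c * r ^ (β - 1)) :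
    |A t - A s| ≤ c / β * t ^ β := by
  have hB (r : ℝ) (hr : r ∈ Icc s t) :
      HasDerivAt (fun r => c / β * (r ^ β - s ^ β)) (c * r ^ (β - 1)) r := by
    refine (((Real.hasDerivAt_rpow_const (Or.inl (hs.trans_le hr.1).ne')).sub_const _).const_mul
      (c / β)).congr_deriv ?_
    field_simp
  have := image_norm_le_of_norm_deriv_right_le_deriv_boundary' (f := fun r => A r - A s)
    (f' := A') (a := s) (b := t) (B := fun r => c / β * (r ^ β - s ^ β))
    (B' := fun r => c * r ^ (β - 1))
    (fun r hr => ((hA r hr).sub_const _).continuousAt.continuousWithinAt)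
    (fun r hr => ((hA r (Ico_subset_Icc_self hr)).sub_const _).hasDerivWithinAt)
    (by simp)
    (fun r hr => (hB r hr).continuousAt.continuousWithinAt)
    (fun r hr => (hB r (Ico_subset_Icc_self hr)).hasDerivWithinAt)
    (fun r hr => hA' r (Ico_subset_Icc_self hr)) (right_mem_Icc.2 hst)
  refine this.trans (mul_le_mul_of_nonneg_left ?_ (by positivity))
  linarith [Real.rpow_nonneg hs.le β]

/-! ### Comparison of averages over concentric balls -/

section AverageComparison

variable {d : ℕ}

/-- Unit cutoffs approximate the indicator function of the open unit ball. -/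
lemma exists_isUnitCutoff_tendsto (d : ℕ) :
    ∃ χ : ℕ → EuclideanSpace ℝ (Fin d) → ℝ, (∀ k, IsUnitCutoff (χ k)) ∧
      ∀ z, Tendsto (fun k => χ k z) atTop
        (𝓝 ((Metric.ball (0 : EuclideanSpace ℝ (Fin d)) 1).indicator (fun _ => (1 : ℝ)) z)) := by
  have hpos (k : ℕ) : (0 : ℝ) < 1 / (k + 2) := by positivity
  have hlt (k : ℕ) : (1 : ℝ) / (k + 2) < 1 := by
    rw [div_lt_one (by positivity)]; linarith [k.cast_nonneg (α := ℝ)]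
  -- The shift by `2` makes the inner radius positive already at `k = 0`. With outer radius exactly
  -- `1`, the cutoffs vanish on the unit sphere, as does the indicator of the open ball.
  let f (k : ℕ) : ContDiffBump (0 : EuclideanSpace ℝ (Fin d)) :=
    { rIn := 1 - 1 / (k + 2)
      rOut := 1
      rIn_pos := by linarith [hlt k]
      rIn_lt_rOut := by linarith [hpos k] }
  refine ⟨fun k => f k, fun k => ⟨(f k).contDiff, fun z => (f k).nonneg, fun z => (f k).le_one,
    fun z hz => (f k).zero_of_le_dist (by simpa using hz)⟩, fun z => ?_⟩
  by_cases hz : ‖z‖ < 1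
  · have hlim : Tendsto (fun k : ℕ => 1 - 1 / ((k : ℝ) + 2)) atTop (𝓝 1) := by
      have h0 : Tendsto (fun k : ℕ => 1 / ((k : ℝ) + 2)) atTop (𝓝 0) :=
        tendsto_const_nhds.div_atTop
          (tendsto_atTop_add_const_right _ _ tendsto_natCast_atTop_atTop)
      simpa using h0.const_sub 1
    rw [indicator_of_mem (by simpa using hz)]
    refine tendsto_const_nhds.congr' ?_
    filter_upwards [hlim.eventually (lt_mem_nhds hz)] with k hk
    exact ((f k).one_of_mem_closedBall (by simpa [f] using hk.le)).symm
  · rw [indicator_of_notMem (by simpa using hz)]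
    refine tendsto_const_nhds.congr fun k => ((f k).zero_of_le_dist ?_).symm
    simpa [f] using not_lt.1 hz

/-- The constant in the comparison of ball averages. -/
noncomputable def averageConst (d : ℕ) (α r₀ : ℝ) : ℝ :=
  (unitBallVolume d)⁻¹ *
    (Real.sqrt (unitBallVolume d) * (r₀ ^ (α / 2))⁻¹ / ((α + 2 - d) / 2))

variable {Ω : Set (EuclideanSpace ℝ (Fin d))} {u : EuclideanSpace ℝ (Fin d) → ℝ}
  {G : EuclideanSpace ℝ (Fin d) → EuclideanSpace ℝ (Fin d)} {x : EuclideanSpace ℝ (Fin d)}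
  {r₀ α E t : ℝ}

lemma averageConst_nonneg (hr₀ : 0 < r₀) (hα : (d : ℝ) - 2 < α) : 0 ≤ averageConst d α r₀ := by
  have hω := unitBallVolume_pos (d := d)
  have hβ : 0 < (α + 2 - d) / 2 := by linarith
  unfold averageConst
  positivity

/-- On the support of the cutoff `|y - x| ≤ t`, which gives a factor `t`; the energy hypothesis
gives `t^(α/2)` and Cauchy-Schwarz `t^(d/2)`. Against `t^(-d-1)` this leaves `t^((α-d)/2)`, with a
constant independent of `χ`. -/
lemma IsUnitCutoff.abs_deriv_smoothAverage_le {χ : EuclideanSpace ℝ (Fin d) → ℝ}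
    (h : IsUnitCutoff χ) (hGi : IntegrableOn G Ω) (ht : 0 < t) (hball : Metric.closedBall x t ⊆ Ω)
    (hr₀ : 0 < r₀) (hE : 0 ≤ E)
    (hGE : eLpNorm G 2 (volume.restrict (Metric.ball x t)) ≤
      ENNReal.ofReal (E * (t / r₀) ^ (α / 2))) :
    |(t ^ (d + 1))⁻¹ * ∫ y in Ω, inner ℝ (G y) (y - x) * χ (t⁻¹ • (y - x))| ≤
      Real.sqrt (unitBallVolume d) * (r₀ ^ (α / 2))⁻¹ * E * t ^ ((α + 2 - d) / 2 - 1) := by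
  have hb : Metric.ball x t ⊆ Ω := Metric.ball_subset_closedBall.trans hball
  have hGb : IntegrableOn G (Metric.ball x t) := hGi.mono_set hb
  have h1 : |∫ y in Ω, inner ℝ (G y) (y - x) * χ (t⁻¹ • (y - x))| ≤
      t * ∫ y in Metric.ball x t, ‖G y‖ := by
    rw [← integral_const_mul, ← inter_eq_right.2 hb, ← setIntegral_indicator measurableSet_ball,
      ← Real.norm_eq_abs]
    refine norm_integral_le_of_norm_le ?_ (Eventually.of_forall fun y => ?_)
    · exact (hGi.norm.const_mul t).indicator measurableSet_ball
    · by_cases hy : y ∈ Metric.ball x t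
      · rw [indicator_of_mem hy, norm_mul]
        calc ‖inner ℝ (G y) (y - x)‖ * ‖χ (t⁻¹ • (y - x))‖
            ≤ ‖G y‖ * ‖y - x‖ * 1 :=
              mul_le_mul (norm_inner_le_norm _ _) (h.norm_le_one _) (norm_nonneg _) (by positivity)
          _ ≤ t * ‖G y‖ := by
              rw [mul_one, mul_comm]
              refine mul_le_mul_of_nonneg_right ?_ (norm_nonneg _)
              rw [← dist_eq_norm]; exact (Metric.mem_ball.1 hy).le
      · simp [indicator_of_notMem hy, h.scaled_eq_zero ht hy]
  have h2 := integral_norm_ball_le ht (by positivity) hGb.1 hGE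
  rw [abs_mul, abs_of_pos (by positivity)]
  calc (t ^ (d + 1))⁻¹ * |∫ y in Ω, inner ℝ (G y) (y - x) * χ (t⁻¹ • (y - x))|
      ≤ (t ^ (d + 1))⁻¹ * (t * (E * (t / r₀) ^ (α / 2) *
          Real.sqrt (t ^ d * unitBallVolume d))) := by gcongr; exact h1.trans (by gcongr)
    _ = E * (t / r₀) ^ (α / 2) * ((t ^ d)⁻¹ * Real.sqrt (t ^ d * unitBallVolume d)) := by
        field_simp
        ring
    _ = Real.sqrt (unitBallVolume d) * (r₀ ^ (α / 2))⁻¹ * E *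
          (t ^ (α / 2) * t ^ (-(d : ℝ) / 2)) := by
        rw [sqrt_pow_mul_unitBallVolume ht, Real.div_rpow ht.le hr₀.le]; ring
    _ = _ := by
        rw [← Real.rpow_add ht]; congr 2; ring

lemma IsUnitCutoff.tendsto_smoothAverage {χ : ℕ → EuclideanSpace ℝ (Fin d) → ℝ}
    (hχ : ∀ k, IsUnitCutoff (χ k))
    (hlim : ∀ z, Tendsto (fun k => χ k z) atTop
      (𝓝 ((Metric.ball (0 : EuclideanSpace ℝ (Fin d)) 1).indicator (fun _ => (1 : ℝ)) z)))
    (hu : IntegrableOn u Ω) (ht : 0 < t) (hball : Metric.closedBall x t ⊆ Ω) :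
    Tendsto (fun k => ∫ y in Ω, u y * ((t ^ d)⁻¹ * χ k (t⁻¹ • (y - x)))) atTop
      (𝓝 ((t ^ d)⁻¹ * ∫ y in Metric.ball x t, u y)) := by
  have hb : Metric.ball x t ⊆ Ω := Metric.ball_subset_closedBall.trans hball
  have heq : (t ^ d)⁻¹ * ∫ y in Metric.ball x t, u y =
      ∫ y in Ω, u y * ((t ^ d)⁻¹ * (Metric.ball (0 : EuclideanSpace ℝ (Fin d)) 1).indicator
        (fun _ => (1 : ℝ)) (t⁻¹ • (y - x))) := by
    rw [← integral_const_mul, ← inter_eq_right.2 hb, ← setIntegral_indicator measurableSet_ball]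
    congr 1 with y
    have hiff : t⁻¹ • (y - x) ∈ Metric.ball (0 : EuclideanSpace ℝ (Fin d)) 1 ↔
        y ∈ Metric.ball x t := by
      rw [mem_ball_zero_iff, norm_smul, norm_inv, Real.norm_of_nonneg ht.le, ← div_eq_inv_mul,
        div_lt_one ht, Metric.mem_ball, dist_eq_norm]
    by_cases hy : y ∈ Metric.ball x t
    · rw [indicator_of_mem hy, indicator_of_mem (hiff.2 hy)]; ring
    · rw [indicator_of_notMem hy, indicator_of_notMem (fun h => hy (hiff.1 h))]; ring
  rw [heq]
  refine tendsto_integral_of_dominated_convergence (fun y => ‖u y‖ * (t ^ d)⁻¹)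
    (fun k => hu.1.mul
      (continuous_const.mul ((hχ k).continuous_scaled x t)).aestronglyMeasurable)
    (hu.norm.mul_const _) (fun k => Eventually.of_forall fun y => ?_)
    (Eventually.of_forall fun y => ((hlim _).const_mul _).const_mul _)
  rw [norm_mul, norm_mul, Real.norm_of_nonneg (by positivity : 0 ≤ (t ^ d)⁻¹)]
  refine mul_le_mul_of_nonneg_left ?_ (norm_nonneg _)
  exact mul_le_of_le_one_right (by positivity) ((hχ k).norm_le_one _)

/-- Averages over concentric balls are close when the gradient has small energy near the centre. -/
lemma abs_ballAverage_sub_le (hG : IsWeakGradient Ω u G) (hu : IntegrableOn u Ω)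
    (hGi : IntegrableOn G Ω) (hr₀ : 0 < r₀) (hα : (d : ℝ) - 2 < α) (hE : 0 ≤ E) {s : ℝ}
    (hs : 0 < s) (hst : s ≤ t) (hball : Metric.closedBall x t ⊆ Ω)
    (hGE : ∀ r, 0 < r → r ≤ t → eLpNorm G 2 (volume.restrict (Metric.ball x r)) ≤
      ENNReal.ofReal (E * (r / r₀) ^ (α / 2))) :
    |ballAverage u x t - ballAverage u x s| ≤
      averageConst d α r₀ * E * t ^ ((α + 2 - d) / 2) := by
  obtain ⟨χ, hχ, hlim⟩ := exists_isUnitCutoff_tendsto d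
  have hω := unitBallVolume_pos (d := d)
  have hβ : 0 < (α + 2 - d) / 2 := by linarith
  have hb (r : ℝ) (hr : r ≤ t) : Metric.closedBall x r ⊆ Ω :=
    (Metric.closedBall_subset_closedBall hr).trans hball
  have hsmooth (k : ℕ) := abs_sub_le_rpow_of_hasDerivAt
    (A := fun r => ∫ y in Ω, u y * ((r ^ d)⁻¹ * χ k (r⁻¹ • (y - x)))) hβ hs hst
    (c := Real.sqrt (unitBallVolume d) * (r₀ ^ (α / 2))⁻¹ * E) (by positivity)
    (fun r hr => (hχ k).hasDerivAt_smoothAverage hG hu hGi (hs.trans_le hr.1) (hb r hr.2))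
    (fun r hr => (hχ k).abs_deriv_smoothAverage_le hGi (hs.trans_le hr.1) (hb r hr.2) hr₀ hE
      (hGE r (hs.trans_le hr.1) hr.2))
  have hT := IsUnitCutoff.tendsto_smoothAverage hχ hlim hu (hs.trans_le hst) hball
  have hS := IsUnitCutoff.tendsto_smoothAverage hχ hlim hu hs (hb s hst)
  -- The bound `hsmooth` is the same for every `k`, so it survives the passage from cutoffs to
  -- indicators.
  have := le_of_tendsto (hT.sub hS).abs (Eventually.of_forall hsmooth)
  rw [ballAverage_eq u x (hs.trans_le hst), ballAverage_eq u x hs, ← mul_sub, abs_mul,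
    abs_of_pos (inv_pos.2 hω)]
  refine (mul_le_mul_of_nonneg_left this (inv_pos.2 hω).le).trans (le_of_eq ?_)
  unfold averageConst
  ring

end AverageComparison

/-! ### The weight near `Γ` and the decay of the gradient -/

section WeightedEstimates

variable {d : ℕ} {Ω : Set (EuclideanSpace ℝ (Fin d))} {Γ : Finset (EuclideanSpace ℝ (Fin d))}
  {γ u v : EuclideanSpace ℝ (Fin d) → ℝ} {x : EuclideanSpace ℝ (Fin d)} {R r₀ α t ε₀ : ℝ}

lemma eLpNorm_two_le_of_lintegral_le {X F : Type*} [MeasurableSpace X] [NormedAddCommGroup F]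
    {μ : Measure X} {f : X → F} {b : ℝ} (hb : 0 ≤ b)
    (h : ∫⁻ y, ENNReal.ofReal (‖f y‖ ^ 2) ∂μ ≤ ENNReal.ofReal (b ^ 2)) :
    eLpNorm f 2 μ ≤ ENNReal.ofReal b := by
  rw [eLpNorm_eq_lintegral_rpow_enorm_toReal (by norm_num) (by norm_num)]
  have h1 : ∫⁻ y, ‖f y‖ₑ ^ (2 : ENNReal).toReal ∂μ ≤ ENNReal.ofReal b ^ (2 : ℝ) := by
    refine le_trans (le_of_eq ?_) (h.trans (le_of_eq ?_))
    · congr 1 with y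
      rw [ENNReal.ofReal_pow (norm_nonneg _), ofReal_norm]
      norm_num
    · rw [ENNReal.ofReal_pow hb]; norm_num
  refine (ENNReal.rpow_le_rpow h1 (by norm_num)).trans (le_of_eq ?_)
  rw [← ENNReal.rpow_mul]
  norm_num

/-- For `y ∈ B(x, t)` the distance to `Γ` is at most `|y - x| < t`, and `α ≥ 0` makes the explicit
weight decrease with that distance. It does not matter whether `x` is the nearest point of `Γ`. -/
lemma IsWeight.rpow_le_ae (hd : 1 ≤ d) (hγ : IsWeight Ω Γ R r₀ α γ) (hr₀ : 0 < r₀) (hα : 0 ≤ α)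
    (hx : x ∈ Γ) (ht : t ≤ R / 4) (hball : Metric.closedBall x t ⊆ Ω) :
    ∀ᵐ y ∂volume.restrict (Metric.ball x t), (r₀ / t) ^ α ≤ γ y := by
  -- Positive dimension is what makes the finite set `Γ` null.
  have : Nonempty (Fin d) := ⟨⟨0, hd⟩⟩
  have hnull : ∀ᵐ y : EuclideanSpace ℝ (Fin d), y ∉ (Γ : Set (EuclideanSpace ℝ (Fin d))) :=
    measure_eq_zero_iff_ae_notMem.1 (Γ.finite_toSet.measure_zero _)
  filter_upwards [ae_restrict_of_ae hnull, ae_restrict_mem measurableSet_ball] with y hyΓ hy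
  have hx' : x ∈ (Γ : Set (EuclideanSpace ℝ (Fin d))) := hx
  have hle : Metric.infDist y Γ ≤ t :=
    (Metric.infDist_le_dist_of_mem hx').trans (Metric.mem_ball.1 hy).le
  have hpos : 0 < Metric.infDist y Γ :=
    (Γ.finite_toSet.isClosed.notMem_iff_infDist_pos ⟨x, hx'⟩).1 hyΓ
  rw [hγ.eq_near y ⟨subset_closure (hball (Metric.ball_subset_closedBall hy)), hyΓ⟩
    (hle.trans ht)]
  have : (r₀ / t) ^ α ≤ (r₀ / Metric.infDist y Γ) ^ α := by
    have := hpos.trans_le hle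
    gcongr
  linarith

lemma seminormH1Weighted_nonneg : 0 ≤ seminormH1Weighted Ω γ u := Real.sqrt_nonneg _

lemma normL2_nonneg : 0 ≤ normL2 Ω u := ENNReal.toReal_nonneg

/-- Near a point of `Γ` the gradient of a function of finite weighted energy is small in `L²`. -/
lemma eLpNorm_weakGradient_ball_le (hr₀ : 0 < r₀) (ht : 0 < t)
    (hball : Metric.closedBall x t ⊆ Ω)
    (hγ : ∀ᵐ y ∂volume.restrict (Metric.ball x t), (r₀ / t) ^ α ≤ γ y)
    (hfin : weightedEnergy Ω γ u < ⊤) :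
    eLpNorm (weakGradient Ω u) 2 (volume.restrict (Metric.ball x t)) ≤
      ENNReal.ofReal (seminormH1Weighted Ω γ u * (t / r₀) ^ (α / 2)) := by
  refine eLpNorm_two_le_of_lintegral_le (mul_nonneg seminormH1Weighted_nonneg (by positivity)) ?_
  have h1 : ENNReal.ofReal ((r₀ / t) ^ α) *
      ∫⁻ y in Metric.ball x t, ENNReal.ofReal (‖weakGradient Ω u y‖ ^ 2) ≤
      ENNReal.ofReal (seminormH1Weighted Ω γ u ^ 2) := by
    rw [seminormH1Weighted, Real.sq_sqrt ENNReal.toReal_nonneg, ENNReal.ofReal_toReal hfin.ne,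
      ← lintegral_const_mul' _ _ ENNReal.ofReal_ne_top]
    calc ∫⁻ y in Metric.ball x t, ENNReal.ofReal ((r₀ / t) ^ α) *
          ENNReal.ofReal (‖weakGradient Ω u y‖ ^ 2)
        ≤ ∫⁻ y in Metric.ball x t, ENNReal.ofReal (γ y * ‖weakGradient Ω u y‖ ^ 2) := by
          refine lintegral_mono_ae ?_
          filter_upwards [hγ] with y hy
          rw [← ENNReal.ofReal_mul (by positivity)]
          gcongr
      _ ≤ weightedEnergy Ω γ u :=
          lintegral_mono_set (Metric.ball_subset_closedBall.trans hball)
  have h2 : (seminormH1Weighted Ω γ u * (t / r₀) ^ (α / 2)) ^ 2 =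
      (t / r₀) ^ α * seminormH1Weighted Ω γ u ^ 2 := by
    rw [mul_pow, ← Real.rpow_natCast ((t / r₀) ^ (α / 2)), ← Real.rpow_mul (by positivity),
      Nat.cast_ofNat, div_mul_cancel₀ α two_ne_zero, mul_comm]
  have h3 : ENNReal.ofReal ((t / r₀) ^ α) * ENNReal.ofReal ((r₀ / t) ^ α) = 1 := by
    rw [← ENNReal.ofReal_mul (by positivity), ← Real.mul_rpow (by positivity) (by positivity),
      div_mul_div_cancel₀ hr₀.ne', div_self ht.ne', Real.one_rpow, ENNReal.ofReal_one]
  rw [h2, ENNReal.ofReal_mul (by positivity)]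
  calc _ = ENNReal.ofReal ((t / r₀) ^ α) * (ENNReal.ofReal ((r₀ / t) ^ α) *
      ∫⁻ y in Metric.ball x t, ENNReal.ofReal (‖weakGradient Ω u y‖ ^ 2)) := by
        rw [← mul_assoc, h3, one_mul]
    _ ≤ _ := by gcongr

lemma MemH1.integrableOn (hu : MemH1 Ω u) (hΩ : Bornology.IsBounded Ω) : IntegrableOn u Ω := by
  have : IsFiniteMeasure (volume.restrict Ω) := ⟨by simpa using hΩ.measure_lt_top⟩
  exact hu.1.integrable (by norm_num)

lemma MemH1.isWeakGradient (hu : MemH1 Ω u) : IsWeakGradient Ω u (weakGradient Ω u) := by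
  rw [weakGradient, dif_pos hu.2.1]
  exact hu.2.1.choose_spec

/-- `ε₀` is an admissible radius: the balls of radius `ε₀` around points of `Γ` lie in `Ω`, and in
the region where the weight is explicit. -/
structure IsAdmissibleRadius (Ω : Set (EuclideanSpace ℝ (Fin d)))
    (Γ : Finset (EuclideanSpace ℝ (Fin d))) (R ε₀ : ℝ) : Prop where
  pos : 0 < ε₀
  le : ε₀ ≤ R / 4
  subset : ∀ x ∈ Γ, Metric.closedBall x ε₀ ⊆ Ω

lemma exists_isAdmissibleRadius (hΩ : IsOpen Ω)
    (hΓΩ : (Γ : Set (EuclideanSpace ℝ (Fin d))) ⊆ Ω) (hR : 0 < R) :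
    ∃ ε₀, IsAdmissibleRadius Ω Γ R ε₀ := by
  obtain ⟨δ, hδ, h⟩ := Γ.finite_toSet.isCompact.exists_cthickening_subset_open hΩ hΓΩ
  refine ⟨min δ (R / 4), by positivity, min_le_right _ _, fun x hx => ?_⟩
  exact ((Metric.closedBall_subset_closedBall (min_le_left _ _)).trans
    (Metric.closedBall_subset_cthickening (Finset.mem_coe.2 hx) δ)).trans h

/-- The weight bound is applied at every radius `r ≤ t`, each with its own factor `(r₀/r)^α`; this
supplies the decay that the comparison of averages requires. -/
lemma IsAdmissibleRadius.abs_ballAverage_sub_le (h₀ : IsAdmissibleRadius Ω Γ R ε₀) (hd : 1 ≤ d)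
    (hΩ : Bornology.IsBounded Ω) (hr₀ : 0 < r₀) (hα_nonneg : 0 ≤ α) (hα : (d : ℝ) - 2 < α)
    (hγ : IsWeight Ω Γ R r₀ α γ) (hu : MemH1Weighted Ω γ u) (hx : x ∈ Γ) {s : ℝ} (hs : 0 < s)
    (hst : s ≤ t) (ht : t ≤ ε₀) :
    |ballAverage u x t - ballAverage u x s| ≤
      averageConst d α r₀ * seminormH1Weighted Ω γ u * t ^ ((α + 2 - d) / 2) := by
  have : IsFiniteMeasure (volume.restrict Ω) := ⟨by simpa using hΩ.measure_lt_top⟩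
  have hsub (r : ℝ) (hr : r ≤ t) : Metric.closedBall x r ⊆ Ω :=
    (Metric.closedBall_subset_closedBall (hr.trans ht)).trans (h₀.subset x hx)
  exact _root_.abs_ballAverage_sub_le hu.1.isWeakGradient (hu.1.integrableOn hΩ)
    (hu.1.2.2.integrable (by norm_num)) hr₀ hα seminormH1Weighted_nonneg hs hst (hsub t le_rfl)
    fun r hr hrt => eLpNorm_weakGradient_ball_le hr₀ hr (hsub r hrt)
      (hγ.rpow_le_ae hd hr₀ hα_nonneg hx ((hrt.trans ht).trans h₀.le) (hsub r hrt)) hu.2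

end WeightedEstimates

/-! ### Limits as the radius tends to zero -/

lemma tendsto_mul_rpow_nhdsGT_zero (K : ℝ) {β : ℝ} (hβ : 0 < β) :
    Tendsto (fun t : ℝ => K * t ^ β) (𝓝[>] 0) (𝓝 0) := by
  have h : Tendsto (fun t : ℝ => K * t ^ β) (𝓝 0) (𝓝 (K * 0 ^ β)) :=
    ((Real.continuousAt_rpow_const 0 β (Or.inr hβ.le)).tendsto).const_mul K
  rw [Real.zero_rpow hβ.ne', mul_zero] at h
  exact h.mono_left nhdsWithin_le_nhds

/-- Comparing two radii in `(0, t]` with `t` itself bounds their difference by `2 K t^β`, so `F` is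
Cauchy at `0`. -/
lemma exists_tendsto_of_abs_sub_le_rpow {F : ℝ → ℝ} {K β ε₀ : ℝ} (hε₀ : 0 < ε₀) (hβ : 0 < β)
    (hF : ∀ s t, 0 < s → s ≤ t → t ≤ ε₀ → |F t - F s| ≤ K * t ^ β) :
    ∃ L, Tendsto F (𝓝[>] 0) (𝓝 L) := by
  refine cauchy_map_iff_exists_tendsto.1 (Metric.cauchy_iff.2 ⟨inferInstance, fun e he => ?_⟩)
  have hev : ∀ᶠ t : ℝ in 𝓝[>] 0, K * t ^ β < e / 2 ∧ t ≤ ε₀ ∧ 0 < t :=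
    ((tendsto_mul_rpow_nhdsGT_zero K hβ).eventually (gt_mem_nhds (half_pos he))).and
      ((eventually_nhdsWithin_of_eventually_nhds (ge_mem_nhds hε₀)).and self_mem_nhdsWithin)
  obtain ⟨t, h1, h2, h3⟩ := hev.exists
  refine ⟨F '' Ioc 0 t, image_mem_map (Ioc_mem_nhdsGT h3), ?_⟩
  rintro _ ⟨a, ha, rfl⟩ _ ⟨b, hb, rfl⟩
  have hA := hF a t ha.1 ha.2 h2
  have hB := hF b t hb.1 hb.2 h2
  rw [abs_le] at hA hB
  rw [Real.dist_eq, abs_lt]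
  constructor <;> linarith

lemma EuclideanSpace.norm_le_sqrt_card_mul {ι : Type*} [Fintype ι] (z : EuclideanSpace ℝ ι) {M : ℝ}
    (hM : 0 ≤ M) (h : ∀ i, |z i| ≤ M) : ‖z‖ ≤ Real.sqrt (Fintype.card ι) * M := by
  rw [EuclideanSpace.norm_eq, ← Real.sqrt_sq hM, ← Real.sqrt_mul (by positivity)]
  refine Real.sqrt_le_sqrt ?_
  calc ∑ i, ‖z i‖ ^ 2 ≤ ∑ _i : ι, M ^ 2 :=
        Finset.sum_le_sum fun i _ => pow_le_pow_left₀ (norm_nonneg _) (h i) 2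
    _ = _ := by simp

lemma tendsto_ballAverage_of_continuousAt {d : ℕ} {u : EuclideanSpace ℝ (Fin d) → ℝ}
    {x : EuclideanSpace ℝ (Fin d)} {ε₀ : ℝ} (hε₀ : 0 < ε₀)
    (hu : IntegrableOn u (Metric.ball x ε₀)) (hc : ContinuousAt u x) :
    Tendsto (ballAverage u x) (𝓝[>] 0) (𝓝 (u x)) := by
  rw [Metric.tendsto_nhds]
  intro e he
  obtain ⟨δ, hδ, h⟩ := Metric.continuousAt_iff.1 hc (e / 2) (half_pos he)
  filter_upwards [Ioc_mem_nhdsGT (lt_min hδ hε₀)] with t ht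
  have hpos : 0 < volume.real (Metric.ball x t) := by
    rw [volume_real_ball x ht.1]; have := unitBallVolume_pos (d := d); have := ht.1; positivity
  have hut : IntegrableOn u (Metric.ball x t) :=
    hu.mono_set (Metric.ball_subset_ball (ht.2.trans (min_le_right _ _)))
  have h1 : ballAverage u x t - u x =
      (volume.real (Metric.ball x t))⁻¹ * ∫ y in Metric.ball x t, (u y - u x) := by
    rw [integral_sub hut (integrableOn_const measure_ball_lt_top.ne), setIntegral_const,
      ballAverage, setAverage_eq, smul_eq_mul, smul_eq_mul]
    field_simp
  have h2 : ‖∫ y in Metric.ball x t, (u y - u x)‖ ≤ e / 2 * volume.real (Metric.ball x t) := by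
    refine norm_setIntegral_le_of_norm_le_const measure_ball_lt_top fun y hy => ?_
    rw [← dist_eq_norm]
    exact (h (lt_of_lt_of_le hy (ht.2.trans (min_le_left _ _)))).le
  rw [Real.dist_eq, h1, abs_mul, abs_of_pos (inv_pos.2 hpos), inv_mul_lt_iff₀ hpos]
  rw [Real.norm_eq_abs] at h2
  nlinarith

/-! ### Convergence rate and stability of the trace -/

section TraceEstimates

variable {d : ℕ} {Ω : Set (EuclideanSpace ℝ (Fin d))} {Γ : Finset (EuclideanSpace ℝ (Fin d))}
  {γ u v : EuclideanSpace ℝ (Fin d) → ℝ} {x : EuclideanSpace ℝ (Fin d)} {R r₀ α t ε₀ : ℝ}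

lemma abs_ballAverage_le_normL2 (hu : MemLp u 2 (volume.restrict Ω)) (ht : 0 < t)
    (hball : Metric.closedBall x t ⊆ Ω) :
    |ballAverage u x t| ≤ (unitBallVolume d)⁻¹ * Real.sqrt (unitBallVolume d) *
      (normL2 Ω u * t ^ (-(d : ℝ) / 2)) := by
  have hb : Metric.ball x t ⊆ Ω := Metric.ball_subset_closedBall.trans hball
  refine abs_ballAverage_le ht normL2_nonneg (hu.1.mono_set hb) ?_
  rw [normL2, ENNReal.ofReal_toReal hu.2.ne]
  exact eLpNorm_mono_measure _ (Measure.restrict_mono_set _ hb)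

lemma ballAverage_linear (hu : IntegrableOn u (Metric.ball x t))
    (hv : IntegrableOn v (Metric.ball x t)) (ht : 0 < t) (a b : ℝ) :
    ballAverage (a • u + b • v) x t = a * ballAverage u x t + b * ballAverage v x t := by
  have h : ∫ y in Metric.ball x t, (a • u + b • v) y =
      a * (∫ y in Metric.ball x t, u y) + b * ∫ y in Metric.ball x t, v y := by
    rw [← integral_const_mul, ← integral_const_mul,
      ← integral_add (hu.const_mul a) (hv.const_mul b)]
    rfl
  rw [ballAverage_eq _ x ht, ballAverage_eq u x ht, ballAverage_eq v x ht, h]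
  ring

lemma tendsto_ballAverage_pointTrace (h₀ : IsAdmissibleRadius Ω Γ R ε₀) (hd : 1 ≤ d)
    (hΩ : Bornology.IsBounded Ω) (hr₀ : 0 < r₀) (hα_nonneg : 0 ≤ α) (hα : (d : ℝ) - 2 < α)
    (hγ : IsWeight Ω Γ R r₀ α γ) (hu : MemH1Weighted Ω γ u) (x : Γ) :
    Tendsto (ballAverage u x) (𝓝[>] 0) (𝓝 (pointTrace Γ u x)) :=
  tendsto_nhds_limUnder (exists_tendsto_of_abs_sub_le_rpow h₀.pos
    (by linarith : 0 < (α + 2 - d) / 2) fun _ _ hs hst ht =>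
      h₀.abs_ballAverage_sub_le hd hΩ hr₀ hα_nonneg hα hγ hu x.2 hs hst ht)

/-- The rate of convergence of the ball averages to the trace. -/
lemma abs_ballAverage_sub_pointTrace_le (h₀ : IsAdmissibleRadius Ω Γ R ε₀) (hd : 1 ≤ d)
    (hΩ : Bornology.IsBounded Ω) (hr₀ : 0 < r₀) (hα_nonneg : 0 ≤ α) (hα : (d : ℝ) - 2 < α)
    (hγ : IsWeight Ω Γ R r₀ α γ) (hu : MemH1Weighted Ω γ u) (x : Γ) (ht0 : 0 < t) (ht : t ≤ ε₀) :
    |ballAverage u x t - pointTrace Γ u x| ≤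
      averageConst d α r₀ * seminormH1Weighted Ω γ u * t ^ ((α + 2 - d) / 2) := by
  have hlim := tendsto_ballAverage_pointTrace h₀ hd hΩ hr₀ hα_nonneg hα hγ hu x
  refine le_of_tendsto (hlim.const_sub (ballAverage u x t)).abs ?_
  filter_upwards [Ioc_mem_nhdsGT ht0] with s hs
  exact h₀.abs_ballAverage_sub_le hd hΩ hr₀ hα_nonneg hα hγ hu x.2 hs.1 hs.2 ht

lemma ballAverage_sub_eq (h₀ : IsAdmissibleRadius Ω Γ R ε₀) (hΩ : Bornology.IsBounded Ω)
    (hu : MemH1Weighted Ω γ u) (hv : MemH1Weighted Ω γ v) (hx : x ∈ Γ) (ht0 : 0 < t)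
    (ht : t ≤ ε₀) :
    ballAverage (u - v) x t = ballAverage u x t - ballAverage v x t := by
  have hb : Metric.ball x t ⊆ Ω :=
    (Metric.ball_subset_closedBall.trans (Metric.closedBall_subset_closedBall ht)).trans
      (h₀.subset x hx)
  have := ballAverage_linear ((hu.1.integrableOn hΩ).mono_set hb)
    ((hv.1.integrableOn hΩ).mono_set hb) ht0 1 (-1)
  rw [one_smul, neg_one_smul, ← sub_eq_add_neg] at this
  rw [this]
  ring

/-- Pointwise form of the stability estimate for the trace. -/
lemma abs_pointTrace_sub_le (h₀ : IsAdmissibleRadius Ω Γ R ε₀) (hd : 1 ≤ d) (hR : 0 < R)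
    (hΩ : Bornology.IsBounded Ω) (hr₀ : 0 < r₀) (hα_nonneg : 0 ≤ α) (hα : (d : ℝ) - 2 < α)
    (hγ : IsWeight Ω Γ R r₀ α γ) (hu : MemH1Weighted Ω γ u) (hv : MemH1Weighted Ω γ v) (x : Γ)
    (hN : normL2 Ω (u - v) ^ (2 / (α + 2)) ≤ R / 2) :
    |pointTrace Γ u x - pointTrace Γ v x| ≤
      (averageConst d α r₀ * (2 * ε₀ / R) ^ ((α + 2 - d) / 2) +
        (unitBallVolume d)⁻¹ * Real.sqrt (unitBallVolume d) * (2 * ε₀ / R) ^ (-(d : ℝ) / 2)) *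
      (1 + seminormH1Weighted Ω γ u + seminormH1Weighted Ω γ v) *
      normL2 Ω (u - v) ^ (1 - (d : ℝ) / (α + 2)) := by
  have hε₀ := h₀.pos
  have hα2 : 0 < α + 2 := by linarith
  have hw : MemLp (u - v) 2 (volume.restrict Ω) := hu.1.1.sub hv.1.1
  have hω := unitBallVolume_pos (d := d)
  have hK := averageConst_nonneg (d := d) hr₀ hα
  have hsu : 0 ≤ seminormH1Weighted Ω γ u := seminormH1Weighted_nonneg
  have hsv : 0 ≤ seminormH1Weighted Ω γ v := seminormH1Weighted_nonneg
  have hdiff (t : ℝ) (ht0 : 0 < t) (ht : t ≤ ε₀) :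
      |ballAverage u x t - ballAverage v x t| ≤
        (unitBallVolume d)⁻¹ * Real.sqrt (unitBallVolume d) *
          (normL2 Ω (u - v) * t ^ (-(d : ℝ) / 2)) := by
    rw [← ballAverage_sub_eq h₀ hΩ hu hv x.2 ht0 ht]
    exact abs_ballAverage_le_normL2 hw ht0
      ((Metric.closedBall_subset_closedBall ht).trans (h₀.subset x x.2))
  -- If `‖u - v‖_{L²} = 0`, the radius chosen below would be `0`; instead all small averages of `u`
  -- and `v` agree, hence so do the traces.
  rcases (normL2_nonneg (Ω := Ω) (u := u - v)).eq_or_lt with hN0 | hN0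
  · have heq : pointTrace Γ u x = pointTrace Γ v x := by
      refine tendsto_nhds_unique_of_eventuallyEq
        (tendsto_ballAverage_pointTrace h₀ hd hΩ hr₀ hα_nonneg hα hγ hu x)
        (tendsto_ballAverage_pointTrace h₀ hd hΩ hr₀ hα_nonneg hα hγ hv x) ?_
      filter_upwards [Ioc_mem_nhdsGT hε₀] with t ht
      have := hdiff t ht.1 ht.2
      rw [← hN0, zero_mul, mul_zero] at this
      exact sub_eq_zero.1 (abs_nonpos_iff.1 this)
    rw [heq, sub_self, abs_zero]
    have := normL2_nonneg (Ω := Ω) (u := u - v)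
    positivity
  · set N := normL2 Ω (u - v)
    -- The radius `t = κ N^(2/(α+2))` makes both `t^β` and `N t^(-d/2)` multiples of
    -- `N^(1-d/(α+2))`. The factor `κ` turns the smallness assumption, with bound `R/2`, into `t ≤
    -- ε₀`.
    set κ := 2 * ε₀ / R with hκ
    set c := (unitBallVolume d)⁻¹ * Real.sqrt (unitBallVolume d) with hc
    have hκ0 : 0 < κ := by positivity
    have hc0 : 0 ≤ c := by positivity
    set t := κ * N ^ (2 / (α + 2)) with ht_def
    have ht0 : 0 < t := by positivity
    have ht : t ≤ ε₀ := by
      calc t ≤ κ * (R / 2) := mul_le_mul_of_nonneg_left hN hκ0.le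
        _ = ε₀ := by rw [hκ]; field_simp
    have hpow (β : ℝ) : t ^ β = κ ^ β * N ^ (2 / (α + 2) * β) := by
      rw [ht_def, Real.mul_rpow hκ0.le (by positivity), ← Real.rpow_mul hN0.le]
    have h1 : t ^ ((α + 2 - d) / 2) = κ ^ ((α + 2 - d) / 2) * N ^ (1 - (d : ℝ) / (α + 2)) := by
      rw [hpow]; congr 2; field_simp
    have h2 : N * t ^ (-(d : ℝ) / 2) = κ ^ (-(d : ℝ) / 2) * N ^ (1 - (d : ℝ) / (α + 2)) := by
      have hexp : 1 - (d : ℝ) / (α + 2) = 1 + 2 / (α + 2) * (-(d : ℝ) / 2) := by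
        field_simp
        ring
      rw [hpow, hexp, Real.rpow_add hN0, Real.rpow_one]
      ring
    have hA := abs_ballAverage_sub_pointTrace_le h₀ hd hΩ hr₀ hα_nonneg hα hγ hu x ht0 ht
    have hB := abs_ballAverage_sub_pointTrace_le h₀ hd hΩ hr₀ hα_nonneg hα hγ hv x ht0 ht
    have hC := hdiff t ht0 ht
    rw [h1] at hA hB
    rw [h2] at hC
    set K := averageConst d α r₀
    set P := N ^ (1 - (d : ℝ) / (α + 2))
    set su := seminormH1Weighted Ω γ u
    set sv := seminormH1Weighted Ω γ v
    set k₁ := κ ^ ((α + 2 - d) / 2)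
    set k₂ := κ ^ (-(d : ℝ) / 2)
    have hP : 0 ≤ P := by positivity
    have hk₁ : 0 ≤ k₁ := by positivity
    have hk₂ : 0 ≤ k₂ := by positivity
    have hsum : |pointTrace Γ u x - pointTrace Γ v x| ≤
        K * su * (k₁ * P) + K * sv * (k₁ * P) + c * (k₂ * P) := by
      rw [abs_le] at *
      constructor <;> linarith
    refine hsum.trans ?_
    -- `e1` and `e2` are the terms by which the expanded product form exceeds the sum.
    have e1 : 0 ≤ K * k₁ * P := by positivity
    have e2 : 0 ≤ c * k₂ * P * (su + sv) := by positivity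
    linarith

end TraceEstimates

/-! ### The trace theorem -/

theorem mainTheorem8 {d : ℕ} (hd : 1 ≤ d)
    (Ω : Set (EuclideanSpace ℝ (Fin d))) (hΩ_open : IsOpen Ω)
    (hΩ_bdd : Bornology.IsBounded Ω) (hΩ_lip : HasLipschitzBoundary Ω)
    (Γ : Finset (EuclideanSpace ℝ (Fin d))) (hΓ_ne : Γ.Nonempty)
    (hΓΩ : (Γ : Set (EuclideanSpace ℝ (Fin d))) ⊆ Ω)
    (R : ℝ) (hR : IsSeparation Γ R)
    (r₀ : ℝ) (hr₀ : 0 < r₀)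
    (α : ℝ) (hα_nonneg : 0 ≤ α) (hα : (d : ℝ) - 2 < α)
    (γ : EuclideanSpace ℝ (Fin d) → ℝ) (hγ : IsWeight Ω Γ R r₀ α γ) :
    -- the trace is well defined: the limits of ball averages exist
    (∀ u : EuclideanSpace ℝ (Fin d) → ℝ, MemH1Weighted Ω γ u →
      ∀ x : Γ, Tendsto (ballAverage u x) (𝓝[>] 0) (𝓝 (pointTrace Γ u x))) ∧
    -- the trace is linear on the weighted Sobolev space
    (∀ u v : EuclideanSpace ℝ (Fin d) → ℝ, MemH1Weighted Ω γ u → MemH1Weighted Ω γ v →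
      ∀ a b : ℝ, pointTrace Γ (a • u + b • v) = a • pointTrace Γ u + b • pointTrace Γ v) ∧
    -- the trace is bounded
    (∃ C : ℝ, ∀ u : EuclideanSpace ℝ (Fin d) → ℝ, MemH1Weighted Ω γ u →
      ‖pointTrace Γ u‖ ≤ C * normH1Weighted Ω γ u) ∧
    -- the trace agrees with `u` at points of continuity
    (∀ u : EuclideanSpace ℝ (Fin d) → ℝ, MemH1Weighted Ω γ u →
      ∀ x : Γ, ContinuousAt u x → pointTrace Γ u x = u x) ∧
    -- the stability estimate
    (∃ C : ℝ, ∀ u v : EuclideanSpace ℝ (Fin d) → ℝ, MemH1Weighted Ω γ u → MemH1Weighted Ω γ v →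
      normL2 Ω (u - v) ^ (2 / (α + 2)) ≤ R / 2 →
      ‖pointTrace Γ u - pointTrace Γ v‖ ≤
        C * (1 + seminormH1Weighted Ω γ u + seminormH1Weighted Ω γ v) *
          normL2 Ω (u - v) ^ (1 - (d : ℝ) / (α + 2))) := by
  obtain ⟨ε₀, h₀⟩ := exists_isAdmissibleRadius hΩ_open hΓΩ hR.1
  have hε₀ := h₀.pos
  have hball (x : Γ) : Metric.ball (x : EuclideanSpace ℝ (Fin d)) ε₀ ⊆ Ω :=
    Metric.ball_subset_closedBall.trans (h₀.subset x x.2)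
  have hω := unitBallVolume_pos (d := d)
  have hK := averageConst_nonneg (d := d) hr₀ hα
  have hlim (u) (hu : MemH1Weighted Ω γ u) (x : Γ) :=
    tendsto_ballAverage_pointTrace h₀ hd hΩ_bdd hr₀ hα_nonneg hα hγ hu x
  have hint (u) (hu : MemH1Weighted Ω γ u) (x : Γ) :
      IntegrableOn u (Metric.ball (x : EuclideanSpace ℝ (Fin d)) ε₀) :=
    (hu.1.integrableOn hΩ_bdd).mono_set (hball x)
  refine ⟨hlim, fun u v hu hv a b => ?_, ?_, fun u hu x hc => ?_, ?_⟩
  -- The averages of `a • u + b • v` converge because those of `u` and `v` do, so the weak gradient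
  -- of the combination is never needed.
  · ext x
    refine (Tendsto.congr' ?_
      (((hlim u hu x).const_mul a).add ((hlim v hv x).const_mul b))).limUnder_eq
    filter_upwards [Ioc_mem_nhdsGT hε₀] with t ht
    exact (ballAverage_linear ((hint u hu x).mono_set (Metric.ball_subset_ball ht.2))
      ((hint v hv x).mono_set (Metric.ball_subset_ball ht.2)) ht.1 a b).symm
  -- The constant adds the `L²` bound for the average at radius `ε₀` and its distance to the trace;
  -- the square root passes from coordinates to the Euclidean norm.
  · refine ⟨Real.sqrt (Fintype.card Γ) * ((unitBallVolume d)⁻¹ * Real.sqrt (unitBallVolume d) *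
      ε₀ ^ (-(d : ℝ) / 2) + averageConst d α r₀ * ε₀ ^ ((α + 2 - d) / 2)), fun u hu => ?_⟩
    have hn : 0 ≤ normH1Weighted Ω γ u := Real.sqrt_nonneg _
    have h1 : normL2 Ω u ≤ normH1Weighted Ω γ u :=
      Real.le_sqrt_of_sq_le (by linarith [sq_nonneg (seminormH1Weighted Ω γ u)])
    have h2 : seminormH1Weighted Ω γ u ≤ normH1Weighted Ω γ u :=
      Real.le_sqrt_of_sq_le (by linarith [sq_nonneg (normL2 Ω u)])
    rw [mul_assoc]
    refine EuclideanSpace.norm_le_sqrt_card_mul _ (by positivity) fun x => ?_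
    have hA := abs_ballAverage_le_normL2 hu.1.1 hε₀ (h₀.subset x x.2)
    have hB := abs_ballAverage_sub_pointTrace_le h₀ hd hΩ_bdd hr₀ hα_nonneg hα hγ hu x hε₀ le_rfl
    calc |pointTrace Γ u x|
        ≤ |ballAverage u x ε₀| + |ballAverage u x ε₀ - pointTrace Γ u x| := by
          have := abs_sub (ballAverage u x ε₀) (ballAverage u x ε₀ - pointTrace Γ u x)
          rwa [sub_sub_cancel] at this
      _ ≤ (unitBallVolume d)⁻¹ * Real.sqrt (unitBallVolume d) *
            (normH1Weighted Ω γ u * ε₀ ^ (-(d : ℝ) / 2)) +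
          averageConst d α r₀ * normH1Weighted Ω γ u * ε₀ ^ ((α + 2 - d) / 2) :=
          add_le_add (hA.trans (by gcongr)) (hB.trans (by gcongr))
      _ = _ := by ring
  · exact tendsto_nhds_unique (hlim u hu x)
      (tendsto_ballAverage_of_continuousAt hε₀ (hint u hu x) hc)
  · refine ⟨Real.sqrt (Fintype.card Γ) *
      (averageConst d α r₀ * (2 * ε₀ / R) ^ ((α + 2 - d) / 2) +
        (unitBallVolume d)⁻¹ * Real.sqrt (unitBallVolume d) * (2 * ε₀ / R) ^ (-(d : ℝ) / 2)),
      fun u v hu hv hN => ?_⟩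
    have hR0 := hR.1
    have hsu : 0 ≤ seminormH1Weighted Ω γ u := seminormH1Weighted_nonneg
    have hsv : 0 ≤ seminormH1Weighted Ω γ v := seminormH1Weighted_nonneg
    have hw := normL2_nonneg (Ω := Ω) (u := u - v)
    rw [mul_assoc (Real.sqrt _), mul_assoc (Real.sqrt _)]
    refine EuclideanSpace.norm_le_sqrt_card_mul _ (by positivity) fun x => ?_
    exact abs_pointTrace_sub_le h₀ hd hR0 hΩ_bdd hr₀ hα_nonneg hα hγ hu hv x hN
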